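/- On $\mathbb R^3$ with coordinates $z=(x,y,t)$ let $X=\partial_x+2y\,\partial_t$ and $Y=\partial_y-2x\,\partial_t$ be the Heisenberg vector fields, and for a $C^2$ function $u$ let $$\mathcal H(u)=\begin{pmatrix} X^2u & \tfrac12(XYu+YXu)\\ \tfrac12(XYu+YXu) & Y^2u\end{pmatrix}.$$ Let $\Omega\subset\mathbb R^3$ be open. A function $u\in C^2(\Omega)$ is called $\mathcal H$-convex in $\Omega$ if $\mathcal H(u)$ is positive semidefinite at every point of $\Omega$. Write $\operatorname{osc}_\Omega u=\sup_{z,w\in\Omega}(u(z)-u(w))\in[0,\infty]$ (and $0$ if $\Omega=\emptyset$). Proposition. For every compact set $\Omega'\subset\Omega$ there is a constant $C\in(0,\infty)$, depending only on $\Omega'$ and $\Omega$, such that for every $\mathcal H$-convex $u\in C^2(\Omega)$ the function $\det\mathcal H(u)+12\,u_t^2$ is integrable on $\Omega'$ and $$\int_{\Omega'}\{\det\mathcal H(u)+12\,u_t^2\}\,dz\le C\,(\operatorname{osc}_\Omega u)^2 .$$ -/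

import Mathlib

open scoped ENNReal

noncomputable section

namespace Heisenberg

/-- The space underlying the first Heisenberg group, with coordinates `z = (x, y, t)`. Only its
topology, its differentiable structure and its Lebesgue measure are used. -/
abbrev Point : Type := ℝ × ℝ × ℝ

/-- The horizontal vector field `X = ∂_x + 2 y ∂_t`. -/
def X (u : Point → ℝ) (z : Point) : ℝ := fderiv ℝ u z (1, 0, 2 * z.2.1)

/-- The horizontal vector field `Y = ∂_y - 2 x ∂_t`. -/
def Y (u : Point → ℝ) (z : Point) : ℝ := fderiv ℝ u z (0, 1, -2 * z.1)

/-- The vertical derivative `u_t`. -/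
def T (u : Point → ℝ) (z : Point) : ℝ := fderiv ℝ u z (0, 0, 1)

/-- The symmetrized horizontal Hessian `H(u)`. -/
def hess (u : Point → ℝ) (z : Point) : Matrix (Fin 2) (Fin 2) ℝ :=
  !![X (X u) z, (X (Y u) z + Y (X u) z) / 2;
     (X (Y u) z + Y (X u) z) / 2, Y (Y u) z]

/-- `u` belongs to `C²(Ω)` and is H-convex in the open set `Ω`: its symmetrized horizontal Hessian
is positive semidefinite at every point of `Ω`. -/
structure HConvexC2 (Ω : Set Point) (u : Point → ℝ) : Prop where
  contDiffOn : ContDiffOn ℝ 2 u Ω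
  posSemidef : ∀ z ∈ Ω, (hess u z).PosSemidef

/-- The integrand `det H(u) + 12 u_t²`. -/
def maOp (u : Point → ℝ) (z : Point) : ℝ := (hess u z).det + 12 * T u z ^ 2

/-- The oscillation `sup_Ω u - inf_Ω u = sup {u(z) - u(w) : z, w ∈ Ω}`, with value `∞` if `u` is
unbounded on `Ω`. -/
def osc (Ω : Set Point) (u : Point → ℝ) : ℝ≥0∞ :=
  ⨆ z ∈ Ω, ⨆ w ∈ Ω, ENNReal.ofReal (u z - u w)

end Heisenberg

end

open scoped ENNReal

open MeasureTheory Filter Topology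

namespace Heisenberg

/-! The operator is a null Lagrangian up to derivatives of a cutoff. With m = (XYv+YXv)/2 and [X,Y]
= -4T, one has XYv·YXv = m² - 4(Tv)². Hence XXv·YYv - XYv·YXv = det H(v) + 4(Tv)². Integrating this
by parts leaves terms η(Xv·TYv - Yv·TXv), and removing those costs a further 8(Tv)²: this is the
origin of 12. What remains, `flux`, is linear in second derivatives, with coefficients (derivative
of η)·(gradient of v). Further divergences remove its Tv terms, which convexity does not control, so
only the symmetrized Hessian is left.

A positive semidefinite Hessian is bounded by its trace XXv + YYv, whose integral against a cutoff θ
is at most M ∫(|Xθ|+|Yθ|) when the horizontal gradient is bounded by M. So ∫ η·maOp ≲ M². Finally, u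
is convex along horizontal lines, so M ≤ osc/r on a compact set.

Since u is only C², the integrations by parts must avoid third derivatives;
`integral_fderiv_mul_fderiv_comm` achieves this with difference quotients. -/

instance isAddHaarMeasure_volume : (volume : Measure Point).IsAddHaarMeasure := by
  have : (volume : Measure (ℝ × ℝ)).IsAddHaarMeasure :=
    inferInstanceAs ((volume : Measure ℝ).prod (volume : Measure ℝ)).IsAddHaarMeasure
  exact inferInstanceAs ((volume : Measure ℝ).prod (volume : Measure (ℝ × ℝ))).IsAddHaarMeasure

/-! ### Integration by parts for C¹ functions along constant directions. -/

section ConstantDirections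

theorem integral_fderiv_apply_eq_zero {f : Point → ℝ} (hf : ContDiff ℝ 1 f)
    (hc : HasCompactSupport f) (a : Point) : ∫ z, fderiv ℝ f z a = 0 := by
  have hd : Continuous fun z => fderiv ℝ f z a :=
    (hf.continuous_fderiv one_ne_zero).clm_apply continuous_const
  have := integral_mul_fderiv_eq_neg_fderiv_mul_of_integrable (μ := (volume : Measure Point))
    (f := fun _ : Point => (1 : ℝ)) (g := f) (v := a) (by simp)
    (by simpa using hd.integrable_of_hasCompactSupport (hc.fderiv_apply ℝ a))
    (by simpa using hf.continuous.integrable_of_hasCompactSupport hc)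
    (fun _ _ => by fun_prop) (fun z _ => (hf.differentiable one_ne_zero) z)
  simpa using this

/-- For C² functions, two integrations by parts give this at once. For C¹ functions the derivative
along a is replaced by a difference quotient, which moves across by translation invariance, and the
step tends to 0. -/
theorem integral_fderiv_mul_fderiv_comm {h g : Point → ℝ} (hh : ContDiff ℝ 1 h)
    (hhc : HasCompactSupport h) (hg : ContDiff ℝ 1 g) (hgc : HasCompactSupport g) (a b : Point) :
    ∫ z, fderiv ℝ h z a * fderiv ℝ g z b = ∫ z, fderiv ℝ h z b * fderiv ℝ g z a := by
  have hgb : Continuous fun z => fderiv ℝ g z b :=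
    (hg.continuous_fderiv one_ne_zero).clm_apply continuous_const
  have hhb : Continuous fun z => fderiv ℝ h z b :=
    (hh.continuous_fderiv one_ne_zero).clm_apply continuous_const
  have hgbc : HasCompactSupport fun z => fderiv ℝ g z b := hgc.fderiv_apply ℝ b
  have hhbc : HasCompactSupport fun z => fderiv ℝ h z b := hhc.fderiv_apply ℝ b
  have hhd := hh.differentiable one_ne_zero
  have hgd := hg.differentiable one_ne_zero
  obtain ⟨C, hC⟩ := ContDiff.lipschitzWith_of_hasCompactSupport hhc hh one_ne_zero
  obtain ⟨D, hD⟩ := ContDiff.lipschitzWith_of_hasCompactSupport hgc hg one_ne_zero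
  have l1 := hC.integral_inv_smul_sub_mul_tendsto_integral_lineDeriv_mul (μ := volume)
    (hgb.integrable_of_hasCompactSupport hgbc) a
  have l2 := hD.integral_inv_smul_sub_mul_tendsto_integral_lineDeriv_mul (μ := volume)
    (hhb.integrable_of_hasCompactSupport hhbc) (-a)
  simp only [(hhd _).lineDeriv_eq_fderiv, (hgd _).lineDeriv_eq_fderiv, map_neg] at l1 l2
  -- Discrete version: one integration by parts along b in each term, then translation by -sa.
  have key : ∀ s : ℝ, ∫ z, (s⁻¹ • (h (z + s • a) - h z)) * fderiv ℝ g z b =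
      - ∫ z, (s⁻¹ • (g (z + s • (-a)) - g z)) * fderiv ℝ h z b := by
    intro s
    have hsd : ContDiff ℝ 1 fun z => h (z + s • a) := hh.comp (contDiff_id.add contDiff_const)
    have hsc : HasCompactSupport fun z => h (z + s • a) :=
      hhc.comp_homeomorph (Homeomorph.addRight (s • a))
    have hfd : ∀ z, fderiv ℝ (fun z => h (z + s • a)) z b = fderiv ℝ h (z + s • a) b :=
      fun z => by rw [fderiv_comp_add_right]
    have ibp : ∀ k : Point → ℝ, ContDiff ℝ 1 k → HasCompactSupport k →
        Integrable (fun z => k z * fderiv ℝ g z b) ∧ Integrable (fun z => fderiv ℝ k z b * g z) ∧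
        ∫ z, k z * fderiv ℝ g z b = - ∫ z, fderiv ℝ k z b * g z := by
      intro k hk hkc
      have hkb : Continuous fun z => fderiv ℝ k z b :=
        (hk.continuous_fderiv one_ne_zero).clm_apply continuous_const
      have i1 : Integrable (fun z => k z * fderiv ℝ g z b) :=
        (hk.continuous.mul hgb).integrable_of_hasCompactSupport hkc.mul_right
      have i2 : Integrable (fun z => fderiv ℝ k z b * g z) :=
        (hkb.mul hg.continuous).integrable_of_hasCompactSupport hgc.mul_left
      exact ⟨i1, i2, integral_mul_fderiv_eq_neg_fderiv_mul_of_integrable i2 i1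
        ((hk.continuous.mul hg.continuous).integrable_of_hasCompactSupport hkc.mul_right)
        (fun z _ => hk.differentiable one_ne_zero z) (fun z _ => hgd z)⟩
    obtain ⟨i1, i2, e1⟩ := ibp h hh hhc
    obtain ⟨j1, j2, e2⟩ := ibp _ hsd hsc
    have e3 : ∫ z, fderiv ℝ h (z + s • a) b * g z = ∫ z, g (z + s • (-a)) * fderiv ℝ h z b := by
      rw [← integral_add_right_eq_self _ (s • (-a))]
      simp [mul_comm]
    have i3 : Integrable fun z => g (z + s • (-a)) * fderiv ℝ h z b :=
      ((hg.continuous.comp (continuous_id.add continuous_const)).mul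
        hhb).integrable_of_hasCompactSupport hhbc.mul_left
    simp only [smul_eq_mul, mul_assoc, integral_const_mul, sub_mul]
    rw [integral_sub j1 i1, e1, e2, integral_sub i3 (by simpa only [mul_comm] using i2)]
    simp only [hfd, e3, mul_comm (g _)]
    ring
  simp only [key] at l1
  have := tendsto_nhds_unique l1 l2.neg
  rw [this, ← integral_neg]
  exact integral_congr_ae (Eventually.of_forall fun z => by ring)

end ConstantDirections

/-! ### Calculus of X, Y and T: product rules, supports, commutators. -/

section Fields

variable {f g : Point → ℝ} {z : Point}

theorem X_mul (hf : DifferentiableAt ℝ f z) (hg : DifferentiableAt ℝ g z) :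
    X (fun z => f z * g z) z = X f z * g z + f z * X g z := by
  simp only [X, fderiv_fun_mul hf hg]; simp; ring

theorem Y_mul (hf : DifferentiableAt ℝ f z) (hg : DifferentiableAt ℝ g z) :
    Y (fun z => f z * g z) z = Y f z * g z + f z * Y g z := by
  simp only [Y, fderiv_fun_mul hf hg]; simp; ring

theorem X_eq_partial (f : Point → ℝ) (z : Point) :
    X f z = fderiv ℝ f z (1, 0, 0) + 2 * z.2.1 * fderiv ℝ f z (0, 0, 1) := by
  rw [X, ← smul_eq_mul (2 * z.2.1), ← map_smul, ← map_add]; simp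

theorem Y_eq_partial (f : Point → ℝ) (z : Point) :
    Y f z = fderiv ℝ f z (0, 1, 0) - 2 * z.1 * fderiv ℝ f z (0, 0, 1) := by
  rw [Y, ← smul_eq_mul (2 * z.1), ← map_smul, ← map_sub]; simp

variable {m n : WithTop ℕ∞}

theorem contDiffAt_X (hf : ContDiffAt ℝ n f z) (h : m + 1 ≤ n) : ContDiffAt ℝ m (X f) z :=
  (hf.fderiv_right h).clm_apply (by fun_prop)

theorem contDiffAt_Y (hf : ContDiffAt ℝ n f z) (h : m + 1 ≤ n) : ContDiffAt ℝ m (Y f) z :=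
  (hf.fderiv_right h).clm_apply (by fun_prop)

theorem contDiffAt_T (hf : ContDiffAt ℝ n f z) (h : m + 1 ≤ n) : ContDiffAt ℝ m (T f) z :=
  (hf.fderiv_right h).clm_apply (by fun_prop)

theorem contDiff_X (hf : ContDiff ℝ n f) (h : m + 1 ≤ n) : ContDiff ℝ m (X f) :=
  contDiff_iff_contDiffAt.2 fun _ => contDiffAt_X hf.contDiffAt h

theorem contDiff_Y (hf : ContDiff ℝ n f) (h : m + 1 ≤ n) : ContDiff ℝ m (Y f) :=
  contDiff_iff_contDiffAt.2 fun _ => contDiffAt_Y hf.contDiffAt h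

theorem contDiff_T (hf : ContDiff ℝ n f) (h : m + 1 ≤ n) : ContDiff ℝ m (T f) :=
  contDiff_iff_contDiffAt.2 fun _ => contDiffAt_T hf.contDiffAt h

theorem X_eq_zero_of_notMem_tsupport (hz : z ∉ tsupport f) : X f z = 0 := by
  have : fderiv ℝ f z = 0 :=
    Function.notMem_support.1 fun h => hz (support_fderiv_subset ℝ (f := f) h)
  simp [X, this]

theorem Y_eq_zero_of_notMem_tsupport (hz : z ∉ tsupport f) : Y f z = 0 := by
  have : fderiv ℝ f z = 0 :=
    Function.notMem_support.1 fun h => hz (support_fderiv_subset ℝ (f := f) h)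
  simp [Y, this]

theorem tsupport_X_subset (f : Point → ℝ) : tsupport (X f) ⊆ tsupport f :=
  closure_minimal (fun _ hz => by_contra fun h => hz (X_eq_zero_of_notMem_tsupport h))
    (isClosed_tsupport f)

theorem tsupport_Y_subset (f : Point → ℝ) : tsupport (Y f) ⊆ tsupport f :=
  closure_minimal (fun _ hz => by_contra fun h => hz (Y_eq_zero_of_notMem_tsupport h))
    (isClosed_tsupport f)

theorem hasCompactSupport_X (hf : HasCompactSupport f) : HasCompactSupport (X f) :=
  hf.of_isClosed_subset (isClosed_tsupport _) (tsupport_X_subset f)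

theorem hasCompactSupport_Y (hf : HasCompactSupport f) : HasCompactSupport (Y f) :=
  hf.of_isClosed_subset (isClosed_tsupport _) (tsupport_Y_subset f)

/-- The commutation relation `[X, Y] = -4 T`. -/
theorem X_Y_sub_Y_X (hf : ContDiffAt ℝ 2 f z) : X (Y f) z - Y (X f) z = -4 * T f z := by
  have h := VectorField.fderiv_apply_lieBracket_of_isSymmSndFDerivAt (𝕜 := ℝ)
    (V := fun z : Point => ((1, 0, 2 * z.2.1) : Point))
    (W := fun z : Point => ((0, 1, -2 * z.1) : Point)) hf (hf.isSymmSndFDerivAt (by simp))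
    (by fun_prop) (by fun_prop)
  have hV : HasFDerivAt (fun z : Point => ((1, 0, 2 * z.2.1) : Point)) _ z :=
    (hasFDerivAt_const _ _).prodMk
      ((hasFDerivAt_const _ _).prodMk ((hasFDerivAt_snd (𝕜 := ℝ) (p := z)).fst.const_mul (2 : ℝ)))
  have hW : HasFDerivAt (fun z : Point => ((0, 1, -2 * z.1) : Point)) _ z :=
    (hasFDerivAt_const _ _).prodMk
      ((hasFDerivAt_const _ _).prodMk ((hasFDerivAt_fst (𝕜 := ℝ) (p := z)).const_mul (-2 : ℝ)))
  have hb : VectorField.lieBracket ℝ (fun z : Point => ((1, 0, 2 * z.2.1) : Point))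
      (fun z : Point => ((0, 1, -2 * z.1) : Point)) z = (-4 : ℝ) • ((0, 0, 1) : Point) := by
    simp only [VectorField.lieBracket, hV.fderiv, hW.fderiv]
    ext <;> (simp; try norm_num)
  rw [hb, map_smul, smul_eq_mul] at h
  exact h.symm

theorem X_T_eq_T_X (hf : ContDiffAt ℝ 2 f z) : X (T f) z = T (X f) z := by
  have h := VectorField.fderiv_apply_lieBracket_of_isSymmSndFDerivAt (𝕜 := ℝ)
    (V := fun z : Point => ((1, 0, 2 * z.2.1) : Point))
    (W := fun _ : Point => ((0, 0, 1) : Point)) hf (hf.isSymmSndFDerivAt (by simp))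
    (by fun_prop) (by fun_prop)
  have hV : HasFDerivAt (fun z : Point => ((1, 0, 2 * z.2.1) : Point)) _ z :=
    (hasFDerivAt_const _ _).prodMk
      ((hasFDerivAt_const _ _).prodMk ((hasFDerivAt_snd (𝕜 := ℝ) (p := z)).fst.const_mul (2 : ℝ)))
  have hb : VectorField.lieBracket ℝ (fun z : Point => ((1, 0, 2 * z.2.1) : Point))
      (fun _ : Point => ((0, 0, 1) : Point)) z = 0 := by
    simp only [VectorField.lieBracket, hV.fderiv]
    ext <;> simp
  rw [hb, map_zero] at h
  exact sub_eq_zero.1 h.symm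

theorem Y_T_eq_T_Y (hf : ContDiffAt ℝ 2 f z) : Y (T f) z = T (Y f) z := by
  have h := VectorField.fderiv_apply_lieBracket_of_isSymmSndFDerivAt (𝕜 := ℝ)
    (V := fun z : Point => ((0, 1, -2 * z.1) : Point))
    (W := fun _ : Point => ((0, 0, 1) : Point)) hf (hf.isSymmSndFDerivAt (by simp))
    (by fun_prop) (by fun_prop)
  have hV : HasFDerivAt (fun z : Point => ((0, 1, -2 * z.1) : Point)) _ z :=
    (hasFDerivAt_const _ _).prodMk
      ((hasFDerivAt_const _ _).prodMk ((hasFDerivAt_fst (𝕜 := ℝ) (p := z)).const_mul (-2 : ℝ)))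
  have hb : VectorField.lieBracket ℝ (fun z : Point => ((0, 1, -2 * z.1) : Point))
      (fun _ : Point => ((0, 0, 1) : Point)) z = 0 := by
    simp only [VectorField.lieBracket, hV.fderiv]
    ext <;> simp
  rw [hb, map_zero] at h
  exact sub_eq_zero.1 h.symm

end Fields

/-- `f` is integrable with vanishing integral. -/
def ZeroIntegral (f : Point → ℝ) : Prop := Integrable f ∧ ∫ z, f z = 0

namespace ZeroIntegral

variable {f g : Point → ℝ}

theorem add (hf : ZeroIntegral f) (hg : ZeroIntegral g) : ZeroIntegral fun z => f z + g z :=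
  ⟨hf.1.add hg.1, by rw [integral_add hf.1 hg.1, hf.2, hg.2, add_zero]⟩

theorem const_mul (hf : ZeroIntegral f) (c : ℝ) : ZeroIntegral fun z => c * f z :=
  ⟨hf.1.const_mul c, by rw [integral_const_mul, hf.2, mul_zero]⟩

end ZeroIntegral

/-! ### Integrals of divergences along X and Y. -/

section

variable {f h g : Point → ℝ}

theorem zeroIntegral_fderiv_apply (hf : ContDiff ℝ 1 f) (hc : HasCompactSupport f) (a : Point) :
    ZeroIntegral fun z => fderiv ℝ f z a :=
  ⟨((hf.continuous_fderiv one_ne_zero).clm_apply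
    continuous_const).integrable_of_hasCompactSupport (hc.fderiv_apply ℝ a),
    integral_fderiv_apply_eq_zero hf hc a⟩

theorem zeroIntegral_fderiv_swap (hh : ContDiff ℝ 1 h)
    (hhc : HasCompactSupport h) (hg : ContDiff ℝ 1 g) (hgc : HasCompactSupport g) (a b : Point) :
    ZeroIntegral fun z => fderiv ℝ h z a * fderiv ℝ g z b - fderiv ℝ h z b * fderiv ℝ g z a := by
  have hi : ∀ a b : Point, Integrable fun z => fderiv ℝ h z a * fderiv ℝ g z b := fun a b =>
    (((hh.continuous_fderiv one_ne_zero).clm_apply continuous_const).mul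
      ((hg.continuous_fderiv one_ne_zero).clm_apply
        continuous_const)).integrable_of_hasCompactSupport (hhc.fderiv_apply ℝ a).mul_right
  exact ⟨(hi a b).sub (hi b a), by
    rw [integral_sub (hi a b) (hi b a), integral_fderiv_mul_fderiv_comm hh hhc hg hgc, sub_self]⟩

theorem fderiv_two_mul_fst_mul {z : Point} (hf : DifferentiableAt ℝ f z) (a : Point) :
    fderiv ℝ (fun z : Point => 2 * z.1 * f z) z a = 2 * a.1 * f z + 2 * z.1 * fderiv ℝ f z a := by
  have h := (hasFDerivAt_fst (𝕜 := ℝ) (p := z)).const_mul (2 : ℝ)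
  rw [(h.fun_mul hf.hasFDerivAt).fderiv]
  simp; ring

theorem fderiv_two_mul_snd_mul {z : Point} (hf : DifferentiableAt ℝ f z) (a : Point) :
    fderiv ℝ (fun z : Point => 2 * z.2.1 * f z) z a =
      2 * a.2.1 * f z + 2 * z.2.1 * fderiv ℝ f z a := by
  have h := (hasFDerivAt_snd (𝕜 := ℝ) (p := z)).fst.const_mul (2 : ℝ)
  rw [(h.fun_mul hf.hasFDerivAt).fderiv]
  simp; ring

theorem zeroIntegral_X (hf : ContDiff ℝ 1 f) (hc : HasCompactSupport f) :
    ZeroIntegral (X f) := by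
  have hd := hf.differentiable one_ne_zero
  have h2 := zeroIntegral_fderiv_apply (f := fun z => 2 * z.2.1 * f z) (by fun_prop)
    hc.mul_left (0, 0, 1)
  convert (zeroIntegral_fderiv_apply hf hc (1, 0, 0)).add h2 using 2 with z
  rw [X_eq_partial, fderiv_two_mul_snd_mul (hd z)]
  ring

theorem zeroIntegral_Y (hf : ContDiff ℝ 1 f) (hc : HasCompactSupport f) :
    ZeroIntegral (Y f) := by
  have hd := hf.differentiable one_ne_zero
  have h2 := (zeroIntegral_fderiv_apply (f := fun z => 2 * z.1 * f z) (by fun_prop)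
    hc.mul_left (0, 0, 1)).const_mul (-1)
  convert (zeroIntegral_fderiv_apply hf hc (0, 1, 0)).add h2 using 2 with z
  rw [Y_eq_partial, fderiv_two_mul_fst_mul (hd z)]
  ring

/-- The coefficients 2y and 2x are absorbed into h, so that constant-direction swaps apply.
Differentiating these coefficients produces the term -4hTg, the weak form of [X, Y] = -4T. -/
theorem zeroIntegral_bracket (hh : ContDiff ℝ 1 h) (hhc : HasCompactSupport h)
    (hg : ContDiff ℝ 1 g) (hgc : HasCompactSupport g) :
    ZeroIntegral fun z => X h z * Y g z - Y h z * X g z - 4 * (h z * T g z) := by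
  have hd := hh.differentiable one_ne_zero
  have h1 := zeroIntegral_fderiv_swap hh hhc hg hgc (1, 0, 0) (0, 1, 0)
  have h2 := zeroIntegral_fderiv_swap (h := fun z => 2 * z.2.1 * h z) (by fun_prop)
    hhc.mul_left hg hgc (0, 0, 1) (0, 1, 0)
  have h3 := (zeroIntegral_fderiv_swap (h := fun z => 2 * z.1 * h z) (by fun_prop)
    hhc.mul_left hg hgc (1, 0, 0) (0, 0, 1)).const_mul (-1)
  convert (h1.add h2).add h3 using 2 with z
  simp only [X_eq_partial, Y_eq_partial, T, fderiv_two_mul_fst_mul (hd z),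
    fderiv_two_mul_snd_mul (hd z)]
  ring

end

/-! ### The null Lagrangian identity and the resulting integral bound. -/

section NullLagrangian

variable {η v θ : Point → ℝ}

theorem maOp_eq (u : Point → ℝ) (z : Point) :
    maOp u z = X (X u) z * Y (Y u) z - ((X (Y u) z + Y (X u) z) / 2) ^ 2 + 12 * T u z ^ 2 := by
  simp only [maOp, hess, Matrix.det_fin_two_of]; ring

/-- The density obtained from `η * maOp v` by integrating by parts. It is linear in the second
derivatives of `v`, which enter only through the symmetrized Hessian. -/
noncomputable def flux (η v : Point → ℝ) (z : Point) : ℝ :=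
  -(5 / 4) * (X η z * X v z * Y (Y v) z + Y η z * Y v z * X (X v) z)
    + 1 / 2 * (Y η z * X v z + X η z * Y v z) * ((X (Y v) z + Y (X v) z) / 2)
    + 3 / 8 * (Y (Y η) z * X v z ^ 2 + X (X η) z * Y v z ^ 2)
    - 3 / 4 * (X (Y η) z + Y (X η) z) * (X v z * Y v z)

theorem zeroIntegral_mul_maOp_sub_flux (hη : ContDiff ℝ 2 η) (hηc : HasCompactSupport η)
    (hv : ContDiff ℝ 2 v) (hvc : HasCompactSupport v) :
    ZeroIntegral fun z => η z * maOp v z - flux η v z := by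
  have h12 : (1 : WithTop ℕ∞) + 1 ≤ 2 := by norm_num
  have hη1 : ContDiff ℝ 1 η := hη.of_le (by norm_num)
  have hXη := contDiff_X hη h12
  have hYη := contDiff_Y hη h12
  have hXv := contDiff_X hv h12
  have hYv := contDiff_Y hv h12
  have hTv := contDiff_T hv h12
  have cX := hasCompactSupport_X hvc
  have cY := hasCompactSupport_Y hvc
  -- `z1` and `z2` give det H + 4(Tv)² together with -2η(Xv·TYv - Yv·TXv); `z3` and `z4` cancel the
  -- latter and add 8(Tv)². The remaining 3Tv(Yη·Xv - Xη·Yv) is cancelled by `z5` to `z8`, at the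
  -- price of second derivatives of η.
  have z1 := (zeroIntegral_bracket (hη1.mul hXv) hηc.mul_right hYv cY).const_mul (1 / 2)
  have z2 := (zeroIntegral_bracket (hη1.mul hYv) hηc.mul_right hXv cX).const_mul (-(1 / 2))
  have z3 := (zeroIntegral_Y ((hη1.mul hXv).mul hTv) hηc.mul_right.mul_right).const_mul 2
  have z4 := (zeroIntegral_X ((hη1.mul hYv).mul hTv) hηc.mul_right.mul_right).const_mul (-2)
  have z5 := (zeroIntegral_Y ((hYη.mul hXv).mul hXv) cX.mul_left).const_mul (-(3 / 8))
  have z6 := (zeroIntegral_X ((hYη.mul hXv).mul hYv) cY.mul_left).const_mul (3 / 4)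
  have z7 := (zeroIntegral_Y ((hXη.mul hXv).mul hYv) cY.mul_left).const_mul (3 / 4)
  have z8 := (zeroIntegral_X ((hXη.mul hYv).mul hYv) cY.mul_left).const_mul (-(3 / 8))
  convert ((((((z1.add z2).add z3).add z4).add z5).add z6).add z7).add z8 using 2 with z
  have dη : DifferentiableAt ℝ η z := hη1.differentiable one_ne_zero z
  have dXη := hXη.differentiable one_ne_zero z
  have dYη := hYη.differentiable one_ne_zero z
  have dXv := hXv.differentiable one_ne_zero z
  have dYv := hYv.differentiable one_ne_zero z
  have dTv := hTv.differentiable one_ne_zero z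
  rw [X_mul dη dXv, Y_mul dη dXv, X_mul dη dYv, Y_mul dη dYv,
    Y_mul (dη.fun_mul dXv) dTv, X_mul (dη.fun_mul dYv) dTv, Y_mul (dYη.fun_mul dXv) dXv,
    X_mul (dYη.fun_mul dXv) dYv, Y_mul (dXη.fun_mul dXv) dYv, X_mul (dXη.fun_mul dYv) dYv,
    Y_mul dη dXv, X_mul dη dYv, Y_mul dYη dXv, X_mul dYη dXv, Y_mul dXη dXv, X_mul dXη dYv,
    X_T_eq_T_X hv.contDiffAt, Y_T_eq_T_Y hv.contDiffAt, maOp_eq, flux]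
  have hT : T v z = (Y (X v) z - X (Y v) z) / 4 := by
    linarith [X_Y_sub_Y_X (hv.contDiffAt (x := z))]
  rw [hT]
  ring

/-- The coefficients add up to 7/4 in front of the trace and 9/4 in front of M; both are rounded up
to 3. -/
theorem abs_flux_le {B M : ℝ} {z : Point} (hX : |X η z| ≤ B) (hY : |Y η z| ≤ B)
    (hXX : |X (X η) z| ≤ B) (hXY : |X (Y η) z| ≤ B) (hYX : |Y (X η) z| ≤ B)
    (hYY : |Y (Y η) z| ≤ B) (hf : |X v z| ≤ M) (hg : |Y v z| ≤ M)
    (hp : 0 ≤ X (X v) z) (hq : 0 ≤ Y (Y v) z)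
    (hm : |(X (Y v) z + Y (X v) z) / 2| ≤ (X (X v) z + Y (Y v) z) / 2) :
    flux η v z ≤ 3 * B * M * (X (X v) z + Y (Y v) z + M) := by
  have hB : 0 ≤ B := (abs_nonneg _).trans hX
  have hM : 0 ≤ M := (abs_nonneg _).trans hf
  have hBM : 0 ≤ B * M := mul_nonneg hB hM
  have m2 : ∀ {a b : ℝ}, |a| ≤ B → |b| ≤ M → |a * b| ≤ B * M := fun ha hb => by
    rw [abs_mul]; exact mul_le_mul ha hb (abs_nonneg _) hB
  have m3 : ∀ {a b c d : ℝ}, |a * b| ≤ B * M → |c| ≤ d → |a * b * c| ≤ B * M * d :=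
    fun ha hc => by rw [abs_mul]; exact mul_le_mul ha hc (abs_nonneg _) hBM
  have e1 := abs_le.1 (m3 (m2 hX hf) (abs_of_nonneg hq).le)
  have e2 := abs_le.1 (m3 (m2 hY hg) (abs_of_nonneg hp).le)
  have e3 := abs_le.1 (m3 (m2 hY hf) hm)
  have e4 := abs_le.1 (m3 (m2 hX hg) hm)
  have e5 := abs_le.1 (m3 (m2 hYY hf) hf)
  have e6 := abs_le.1 (m3 (m2 hXX hg) hg)
  have e7 := abs_le.1 (m3 (m2 hXY hf) hg)
  have e8 := abs_le.1 (m3 (m2 hYX hf) hg)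
  have e9 := mul_nonneg hBM hp
  have e10 := mul_nonneg hBM hq
  have e11 := mul_nonneg hBM hM
  rw [flux]
  nlinarith

theorem integral_mul_maOp_le {B M : ℝ} (hη : ContDiff ℝ 2 η) (hηc : HasCompactSupport η)
    (hv : ContDiff ℝ 2 v) (hvc : HasCompactSupport v) (hθ : ContDiff ℝ 1 θ)
    (hθc : HasCompactSupport θ) (hθ0 : ∀ z, 0 ≤ θ z) (hθ1 : ∀ z ∈ tsupport η, θ z = 1)
    (hM0 : 0 ≤ M) (hB0 : 0 ≤ B)
    (hB : ∀ z, |X η z| ≤ B ∧ |Y η z| ≤ B ∧ |X (X η) z| ≤ B ∧ |X (Y η) z| ≤ B ∧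
      |Y (X η) z| ≤ B ∧ |Y (Y η) z| ≤ B)
    (hM : ∀ z ∈ tsupport θ, |X v z| ≤ M ∧ |Y v z| ≤ M)
    (hpos : ∀ z ∈ tsupport θ, 0 ≤ X (X v) z ∧ 0 ≤ Y (Y v) z ∧
      |(X (Y v) z + Y (X v) z) / 2| ≤ (X (X v) z + Y (Y v) z) / 2) :
    Integrable (fun z => η z * maOp v z) ∧
    ∫ z, η z * maOp v z ≤ 3 * B * ((∫ z, (|X θ z| + |Y θ z|)) + ∫ z, θ z) * M ^ 2 := by
  have h12 : (1 : WithTop ℕ∞) + 1 ≤ 2 := by norm_num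
  have hXv := contDiff_X hv h12
  have hYv := contDiff_Y hv h12
  have cXX := (contDiff_X hXv (m := 0) (by simp)).continuous
  have cYY := (contDiff_Y hYv (m := 0) (by simp)).continuous
  have cXY := (contDiff_X hYv (m := 0) (by simp)).continuous
  have cYX := (contDiff_Y hXv (m := 0) (by simp)).continuous
  have cT := (contDiff_T hv h12).continuous
  have cXθ := (contDiff_X hθ (m := 0) (by simp)).continuous
  have cYθ := (contDiff_Y hθ (m := 0) (by simp)).continuous
  have iη : Integrable fun z => η z * maOp v z := by
    refine Continuous.integrable_of_hasCompactSupport ?_ hηc.mul_right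
    simp only [maOp_eq]
    have := hη.continuous
    fun_prop
  obtain ⟨i0, e0⟩ := zeroIntegral_mul_maOp_sub_flux hη hηc hv hvc
  have iflux : Integrable (flux η v) := by
    refine (iη.sub i0).congr (Eventually.of_forall fun z => ?_)
    simp
  have eflux : ∫ z, η z * maOp v z = ∫ z, flux η v z := by
    rw [integral_sub iη iflux] at e0; linarith
  have iθ : Integrable θ := hθ.continuous.integrable_of_hasCompactSupport hθc
  have iA : Integrable fun z => θ z * (X (X v) z + Y (Y v) z) := by
    refine Continuous.integrable_of_hasCompactSupport ?_ hθc.mul_right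
    have := hθ.continuous
    fun_prop
  have iXθ : Integrable (X θ) :=
    cXθ.integrable_of_hasCompactSupport (hasCompactSupport_X hθc)
  have iYθ : Integrable (Y θ) :=
    cYθ.integrable_of_hasCompactSupport (hasCompactSupport_Y hθc)
  have iN : Integrable fun z => |X θ z| + |Y θ z| := iXθ.abs.add iYθ.abs
  -- Subtracting the divergence of θ(Xv, Yv), whose integral vanishes, leaves only -(Xθ·Xv + Yθ·Yv).
  have hA : ∫ z, θ z * (X (X v) z + Y (Y v) z) ≤ M * ∫ z, (|X θ z| + |Y θ z|) := by
    obtain ⟨j0, e⟩ := (zeroIntegral_X (hθ.mul hXv) hθc.mul_right).add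
      (zeroIntegral_Y (hθ.mul hYv) hθc.mul_right)
    have : ∫ z, θ z * (X (X v) z + Y (Y v) z) =
        ∫ z, (θ z * (X (X v) z + Y (Y v) z) -
          (X (fun z => θ z * X v z) z + Y (fun z => θ z * Y v z) z)) := by
      rw [integral_sub iA j0, e, sub_zero]
    rw [this, ← integral_const_mul]
    refine integral_mono (iA.sub j0) (iN.const_mul M) fun z => ?_
    have dθ := hθ.differentiable one_ne_zero z
    simp only
    rw [X_mul dθ (hXv.differentiable one_ne_zero z), Y_mul dθ (hYv.differentiable one_ne_zero z)]
    by_cases hz : z ∈ tsupport θ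
    · obtain ⟨h1, h2⟩ := hM z hz
      have p : ∀ {a b : ℝ}, |b| ≤ M → -(a * b) ≤ M * |a| := fun {a b} hb => by
        refine (neg_le_abs _).trans ?_
        rw [abs_mul, mul_comm]
        exact mul_le_mul_of_nonneg_right hb (abs_nonneg _)
      linarith [p (a := X θ z) h1, p (a := Y θ z) h2]
    · rw [X_eq_zero_of_notMem_tsupport hz, Y_eq_zero_of_notMem_tsupport hz]
      simp only [zero_mul, abs_zero]
      linarith
  refine ⟨iη, ?_⟩
  calc ∫ z, η z * maOp v z = ∫ z, flux η v z := eflux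
    _ ≤ ∫ z, 3 * B * M * (θ z * (X (X v) z + Y (Y v) z) + M * θ z) := by
      refine integral_mono iflux ((iA.add (iθ.const_mul M)).const_mul _) fun z => ?_
      by_cases hz : z ∈ tsupport η
      · have hz' : z ∈ tsupport θ := subset_closure (by simp [hθ1 z hz])
        obtain ⟨b1, b2, b3, b4, b5, b6⟩ := hB z
        obtain ⟨p, q, m⟩ := hpos z hz'
        simpa [hθ1 z hz] using abs_flux_le b1 b2 b3 b4 b5 b6 (hM z hz').1 (hM z hz').2 p q m
      · have e1 := X_eq_zero_of_notMem_tsupport hz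
        have e2 := Y_eq_zero_of_notMem_tsupport hz
        have e3 := X_eq_zero_of_notMem_tsupport fun h => hz (tsupport_X_subset η h)
        have e4 := X_eq_zero_of_notMem_tsupport fun h => hz (tsupport_Y_subset η h)
        have e5 := Y_eq_zero_of_notMem_tsupport fun h => hz (tsupport_X_subset η h)
        have e6 := Y_eq_zero_of_notMem_tsupport fun h => hz (tsupport_Y_subset η h)
        -- Off the support of η the flux vanishes, so the majorant only has to be nonnegative there.
        have hnn : 0 ≤ θ z * (X (X v) z + Y (Y v) z) := by
          by_cases hz' : z ∈ tsupport θ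
          · exact mul_nonneg (hθ0 z) (add_nonneg (hpos z hz').1 (hpos z hz').2.1)
          · rw [image_eq_zero_of_notMem_tsupport hz', zero_mul]
        have : flux η v z = 0 := by simp [flux, e1, e2, e3, e4, e5, e6]
        rw [this]
        exact mul_nonneg (by positivity) (add_nonneg hnn (mul_nonneg hM0 (hθ0 z)))
    _ = 3 * B * M * ((∫ z, θ z * (X (X v) z + Y (Y v) z)) + M * ∫ z, θ z) := by
      rw [integral_const_mul, integral_add iA (iθ.const_mul M), integral_const_mul]
    _ ≤ 3 * B * M * ((M * ∫ z, (|X θ z| + |Y θ z|)) + M * ∫ z, θ z) := by gcongr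
    _ = _ := by ring

end NullLagrangian

/-! ### Locality of the operators and pointwise consequences of positivity. -/

section Regularity

variable {u v : Point → ℝ} {z : Point}

theorem X_congr (h : u =ᶠ[𝓝 z] v) : X u =ᶠ[𝓝 z] X v :=
  (h.fderiv (𝕜 := ℝ)).mono fun _ hw => by simp only [X, hw]

theorem Y_congr (h : u =ᶠ[𝓝 z] v) : Y u =ᶠ[𝓝 z] Y v :=
  (h.fderiv (𝕜 := ℝ)).mono fun _ hw => by simp only [Y, hw]

theorem T_congr (h : u =ᶠ[𝓝 z] v) : T u =ᶠ[𝓝 z] T v :=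
  (h.fderiv (𝕜 := ℝ)).mono fun _ hw => by simp only [T, hw]

theorem hess_congr (h : u =ᶠ[𝓝 z] v) : hess u z = hess v z := by
  simp only [hess, (X_congr (X_congr h)).eq_of_nhds, (X_congr (Y_congr h)).eq_of_nhds,
    (Y_congr (X_congr h)).eq_of_nhds, (Y_congr (Y_congr h)).eq_of_nhds]

theorem maOp_congr (h : u =ᶠ[𝓝 z] v) : maOp u z = maOp v z := by
  simp only [maOp, hess_congr h, (T_congr h).eq_of_nhds]

theorem maOp_nonneg (h : (hess u z).PosSemidef) : 0 ≤ maOp u z :=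
  add_nonneg h.det_nonneg (by positivity)

theorem X_X_nonneg (h : (hess u z).PosSemidef) : 0 ≤ X (X u) z := by
  simpa [hess] using h.diag_nonneg (i := 0)

theorem Y_Y_nonneg (h : (hess u z).PosSemidef) : 0 ≤ Y (Y u) z := by
  simpa [hess] using h.diag_nonneg (i := 1)

/-- The determinant gives m² ≤ pq for off-diagonal entry m and diagonal entries p, q, and pq ≤
((p+q)/2)². -/
theorem abs_offDiag_le (h : (hess u z).PosSemidef) :
    |(X (Y u) z + Y (X u) z) / 2| ≤ (X (X u) z + Y (Y u) z) / 2 := by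
  have h1 := X_X_nonneg h
  have h2 := Y_Y_nonneg h
  have hd := h.det_nonneg
  rw [hess, Matrix.det_fin_two_of] at hd
  refine abs_le_of_sq_le_sq ?_ (by linarith)
  nlinarith [sq_nonneg (X (X u) z - Y (Y u) z)]

end Regularity

/-- A convex function of one variable with oscillation at most `O` has derivative at most `O / r`
at distance `r` from the ends of its interval. -/
theorem abs_deriv_le_of_second_deriv_nonneg {φ φ₁ φ₂ : ℝ → ℝ} {r O : ℝ} (hr : 0 < r)
    (h1 : ∀ s ∈ Set.Icc (-r) r, HasDerivAt φ (φ₁ s) s)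
    (h2 : ∀ s ∈ Set.Icc (-r) r, HasDerivAt φ₁ (φ₂ s) s)
    (h0 : ∀ s ∈ Set.Icc (-r) r, 0 ≤ φ₂ s)
    (hO : ∀ s ∈ Set.Icc (-r) r, φ s - φ 0 ≤ O) : |φ₁ 0| ≤ O / r := by
  -- As φ' is increasing, φ'(0) lies between the mean slopes over [-r, 0] and [0, r].
  have mono : MonotoneOn φ₁ (Set.Icc (-r) r) := by
    refine monotoneOn_of_hasDerivWithinAt_nonneg (convex_Icc _ _)
      (fun s hs => (h2 s hs).continuousAt.continuousWithinAt)
      (fun s hs => (h2 s (interior_subset hs)).hasDerivWithinAt)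
      (fun s hs => h0 s (interior_subset hs))
  have m0 : (0 : ℝ) ∈ Set.Icc (-r) r := ⟨by linarith, hr.le⟩
  obtain ⟨a, ha, ea⟩ := exists_hasDerivAt_eq_slope φ φ₁ hr
    (fun s hs => (h1 s ⟨by linarith [hs.1], hs.2⟩).continuousAt.continuousWithinAt)
    (fun s hs => h1 s ⟨by linarith [hs.1], hs.2.le⟩)
  obtain ⟨b, hb, eb⟩ := exists_hasDerivAt_eq_slope φ φ₁ (neg_lt_zero.2 hr)
    (fun s hs => (h1 s ⟨hs.1, by linarith [hs.2]⟩).continuousAt.continuousWithinAt)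
    (fun s hs => h1 s ⟨hs.1.le, by linarith [hs.2]⟩)
  have la := mono m0 ⟨by linarith [ha.1], ha.2.le⟩ ha.1.le
  have lb := mono ⟨hb.1.le, by linarith [hb.2]⟩ m0 hb.2.le
  rw [ea, sub_zero] at la
  rw [eb, zero_sub, neg_neg] at lb
  have ua := hO r ⟨by linarith, le_rfl⟩
  have ub := hO (-r) ⟨le_rfl, by linarith⟩
  refine abs_le.2 ⟨?_, la.trans (by gcongr)⟩
  refine le_trans ?_ lb
  rw [← neg_div]
  gcongr
  linarith

/-! ### Horizontal gradient bound from convexity along lines. -/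

section Gradient

variable {u : Point → ℝ} {Ω : Set Point} {z : Point}

/-- The coordinate y is constant along this line, so X keeps the same direction on it; the lemma can
therefore be iterated, and the second derivative of u along the line is XXu. -/
theorem hasDerivAt_comp_X_line {f : Point → ℝ} {s : ℝ}
    (hf : DifferentiableAt ℝ f (z + s • ((1, 0, 2 * z.2.1) : Point))) :
    HasDerivAt (fun s : ℝ => f (z + s • ((1, 0, 2 * z.2.1) : Point)))
      (X f (z + s • ((1, 0, 2 * z.2.1) : Point))) s := by
  have h : HasDerivAt (fun s : ℝ => z + s • ((1, 0, 2 * z.2.1) : Point))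
      ((1, 0, 2 * z.2.1) : Point) s := by
    simpa using ((hasDerivAt_id s).smul_const ((1, 0, 2 * z.2.1) : Point)).const_add z
  have e : X f (z + s • ((1, 0, 2 * z.2.1) : Point)) = fderiv ℝ f (z + s • ((1, 0, 2 * z.2.1) : Point)) ((1, 0, 2 * z.2.1) : Point) := by simp [X]
  rw [e]
  exact hf.hasFDerivAt.comp_hasDerivAt s h

theorem hasDerivAt_comp_Y_line {f : Point → ℝ} {s : ℝ}
    (hf : DifferentiableAt ℝ f (z + s • ((0, 1, -2 * z.1) : Point))) :
    HasDerivAt (fun s : ℝ => f (z + s • ((0, 1, -2 * z.1) : Point)))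
      (Y f (z + s • ((0, 1, -2 * z.1) : Point))) s := by
  have h : HasDerivAt (fun s : ℝ => z + s • ((0, 1, -2 * z.1) : Point))
      ((0, 1, -2 * z.1) : Point) s := by
    simpa using ((hasDerivAt_id s).smul_const ((0, 1, -2 * z.1) : Point)).const_add z
  have e : Y f (z + s • ((0, 1, -2 * z.1) : Point)) = fderiv ℝ f (z + s • ((0, 1, -2 * z.1) : Point)) ((0, 1, -2 * z.1) : Point) := by simp [Y]
  rw [e]
  exact hf.hasFDerivAt.comp_hasDerivAt s h

theorem abs_X_le {r O : ℝ} (hΩ : IsOpen Ω) (hu : HConvexC2 Ω u) (hr : 0 < r)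
    (hz : ∀ s ∈ Set.Icc (-r) r, z + s • ((1, 0, 2 * z.2.1) : Point) ∈ Ω)
    (hO : ∀ a ∈ Ω, ∀ b ∈ Ω, u a - u b ≤ O) : |X u z| ≤ O / r := by
  have hc : ∀ s ∈ Set.Icc (-r) r, ContDiffAt ℝ 2 u (z + s • ((1, 0, 2 * z.2.1) : Point)) :=
    fun s hs => hu.contDiffOn.contDiffAt (hΩ.mem_nhds (hz s hs))
  have := abs_deriv_le_of_second_deriv_nonneg hr
    (fun s hs => hasDerivAt_comp_X_line ((hc s hs).differentiableAt (by simp)))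
    (fun s hs => hasDerivAt_comp_X_line
      ((contDiffAt_X (m := 1) (hc s hs) (by norm_num)).differentiableAt (by simp)))
    (fun s hs => X_X_nonneg (hu.posSemidef _ (hz s hs)))
    (fun s hs => hO _ (hz s hs) _ (hz 0 ⟨by linarith, hr.le⟩))
  simpa using this

theorem abs_Y_le {r O : ℝ} (hΩ : IsOpen Ω) (hu : HConvexC2 Ω u) (hr : 0 < r)
    (hz : ∀ s ∈ Set.Icc (-r) r, z + s • ((0, 1, -2 * z.1) : Point) ∈ Ω)
    (hO : ∀ a ∈ Ω, ∀ b ∈ Ω, u a - u b ≤ O) : |Y u z| ≤ O / r := by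
  have hc : ∀ s ∈ Set.Icc (-r) r, ContDiffAt ℝ 2 u (z + s • ((0, 1, -2 * z.1) : Point)) :=
    fun s hs => hu.contDiffOn.contDiffAt (hΩ.mem_nhds (hz s hs))
  have := abs_deriv_le_of_second_deriv_nonneg hr
    (fun s hs => hasDerivAt_comp_Y_line ((hc s hs).differentiableAt (by simp)))
    (fun s hs => hasDerivAt_comp_Y_line
      ((contDiffAt_Y (m := 1) (hc s hs) (by norm_num)).differentiableAt (by simp)))
    (fun s hs => Y_Y_nonneg (hu.posSemidef _ (hz s hs)))
    (fun s hs => hO _ (hz s hs) _ (hz 0 ⟨by linarith, hr.le⟩))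
  simpa using this

theorem sub_le_toReal_osc (h : osc Ω u ≠ ∞) {a b : Point} (ha : a ∈ Ω) (hb : b ∈ Ω) :
    u a - u b ≤ (osc Ω u).toReal := by
  rw [← ENNReal.ofReal_le_iff_le_toReal h]
  exact le_iSup₂_of_le a ha (le_iSup₂_of_le b hb le_rfl)

theorem exists_pos_line_subset {K : Set Point} (hK : IsCompact K) (hΩ : IsOpen Ω) (hKΩ : K ⊆ Ω)
    {W : Point → Point} (hW : Continuous W) :
    ∃ r : ℝ, 0 < r ∧ ∀ z ∈ K, ∀ s ∈ Set.Icc (-r) r, z + s • W z ∈ Ω := by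
  obtain ⟨δ, hδ, hsub⟩ := hK.exists_cthickening_subset_open hΩ hKΩ
  obtain ⟨R, hR⟩ := hK.exists_bound_of_continuousOn hW.continuousOn
  have hR0 : 0 < max R 1 := lt_max_of_lt_right one_pos
  refine ⟨δ / max R 1, by positivity, fun z hz s hs => hsub ?_⟩
  refine Metric.mem_cthickening_of_dist_le _ z _ _ hz ?_
  rw [dist_eq_norm, add_sub_cancel_left, norm_smul, Real.norm_eq_abs]
  calc |s| * ‖W z‖ ≤ δ / max R 1 * max R 1 := by
        gcongr
        · exact abs_le.2 hs
        · exact (hR z hz).trans (le_max_left _ _)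
    _ = δ := div_mul_cancel₀ _ hR0.ne'

end Gradient

/-- Smooth cutoff functions. -/
theorem exists_cutoff {K Ω : Set Point} (hK : IsCompact K) (hΩ : IsOpen Ω) (h : K ⊆ Ω) :
    ∃ χ : Point → ℝ, ContDiff ℝ 2 χ ∧ HasCompactSupport χ ∧ tsupport χ ⊆ Ω ∧
      (∀ᶠ z in 𝓝ˢ K, χ z = 1) ∧ ∀ z, 0 ≤ χ z := by
  obtain ⟨L, hL, hKL, hLΩ⟩ := exists_compact_between hK hΩ h
  obtain ⟨χ, h1, h0, h01⟩ := exists_contMDiffMap_one_nhds_of_subset_interior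
    (n := 2) (modelWithCornersSelf ℝ Point) hK.isClosed hKL
  have hs : tsupport χ ⊆ L := closure_minimal
    (fun z hz => by_contra fun hzL => hz (h0 z hzL)) hL.isClosed
  exact ⟨χ, χ.contMDiff.contDiff, hL.of_isClosed_subset (isClosed_tsupport _) hs, hs.trans hLΩ, h1,
    fun z => (h01 z).1⟩

theorem contDiff_mul_of_tsupport_subset {Ω : Set Point} {χ u : Point → ℝ} (hΩ : IsOpen Ω)
    (hχ : ContDiff ℝ 2 χ) (hs : tsupport χ ⊆ Ω) (hu : ContDiffOn ℝ 2 u Ω) :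
    ContDiff ℝ 2 fun z => χ z * u z := by
  refine contDiff_iff_contDiffAt.2 fun z => ?_
  by_cases hz : z ∈ Ω
  · exact hχ.contDiffAt.mul (hu.contDiffAt (hΩ.mem_nhds hz))
  · have : (fun z => χ z * u z) =ᶠ[𝓝 z] fun _ => 0 := by
      filter_upwards [(isClosed_tsupport χ).isOpen_compl.mem_nhds fun h => hz (hs h)] with w hw
      rw [image_eq_zero_of_notMem_tsupport hw, zero_mul]
    exact contDiffAt_const.congr_of_eventuallyEq this

theorem exists_bound_derivatives {η : Point → ℝ} (hη : ContDiff ℝ 2 η)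
    (hc : HasCompactSupport η) :
    ∃ B, 0 ≤ B ∧ ∀ z, |X η z| ≤ B ∧ |Y η z| ≤ B ∧ |X (X η) z| ≤ B ∧ |X (Y η) z| ≤ B ∧
      |Y (X η) z| ≤ B ∧ |Y (Y η) z| ≤ B := by
  have hX := contDiff_X hη (m := 1) (by norm_num)
  have hY := contDiff_Y hη (m := 1) (by norm_num)
  have cX := hasCompactSupport_X hc
  have cY := hasCompactSupport_Y hc
  obtain ⟨b1, h1⟩ := cX.exists_bound_of_continuous hX.continuous
  obtain ⟨b2, h2⟩ := cY.exists_bound_of_continuous hY.continuous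
  obtain ⟨b3, h3⟩ := (hasCompactSupport_X cX).exists_bound_of_continuous
    (contDiff_X hX (m := 0) (by simp)).continuous
  obtain ⟨b4, h4⟩ := (hasCompactSupport_X cY).exists_bound_of_continuous
    (contDiff_X hY (m := 0) (by simp)).continuous
  obtain ⟨b5, h5⟩ := (hasCompactSupport_Y cX).exists_bound_of_continuous
    (contDiff_Y hX (m := 0) (by simp)).continuous
  obtain ⟨b6, h6⟩ := (hasCompactSupport_Y cY).exists_bound_of_continuous
    (contDiff_Y hY (m := 0) (by simp)).continuous
  have p : ∀ {f : Point → ℝ} {b : ℝ}, (∀ z, ‖f z‖ ≤ b) → 0 ≤ b :=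
    fun h => (norm_nonneg _).trans (h 0)
  have p1 := p h1
  have p2 := p h2
  have p3 := p h3
  have p4 := p h4
  have p5 := p h5
  have p6 := p h6
  simp only [Real.norm_eq_abs] at h1 h2 h3 h4 h5 h6
  exact ⟨b1 + b2 + b3 + b4 + b5 + b6, by positivity, fun z =>
    ⟨by linarith [h1 z], by linarith [h2 z], by linarith [h3 z], by linarith [h4 z],
      by linarith [h5 z], by linarith [h6 z]⟩⟩

theorem continuousOn_maOp {Ω : Set Point} {u : Point → ℝ} (hΩ : IsOpen Ω)
    (hu : ContDiffOn ℝ 2 u Ω) : ContinuousOn (maOp u) Ω := by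
  intro z hz
  have hc := hu.contDiffAt (hΩ.mem_nhds hz)
  have hX := contDiffAt_X hc (m := 1) (by norm_num)
  have hY := contDiffAt_Y hc (m := 1) (by norm_num)
  have h1 := (contDiffAt_X hX (m := 0) (by simp)).continuousAt
  have h2 := (contDiffAt_Y hY (m := 0) (by simp)).continuousAt
  have h3 := (contDiffAt_X hY (m := 0) (by simp)).continuousAt
  have h4 := (contDiffAt_Y hX (m := 0) (by simp)).continuousAt
  have h5 := (contDiffAt_T hc (m := 1) (by norm_num)).continuousAt
  have : maOp u = fun z =>
      X (X u) z * Y (Y u) z - ((X (Y u) z + Y (X u) z) / 2) ^ 2 + 12 * T u z ^ 2 :=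
    funext fun z => maOp_eq u z
  rw [this]
  exact ContinuousAt.continuousWithinAt (by fun_prop)

end Heisenberg

/-! ### Assembly of the estimate. -/

open Heisenberg in
theorem proposition6p2 (Ω Ω' : Set Heisenberg.Point) (hΩ : IsOpen Ω) (hΩ' : IsCompact Ω')
    (hsub : Ω' ⊆ Ω) :
    ∃ C : ℝ, 0 < C ∧ ∀ u : Heisenberg.Point → ℝ, Heisenberg.HConvexC2 Ω u →
      MeasureTheory.IntegrableOn (Heisenberg.maOp u) Ω' MeasureTheory.volume ∧
      ENNReal.ofReal (∫ z in Ω', Heisenberg.maOp u z) ≤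
        ENNReal.ofReal C * Heisenberg.osc Ω u ^ 2 := by
  -- Nested cutoffs: η is 1 near Ω', θ near supp η, χ near supp θ. They are chosen before u, so the
  -- constant depends only on Ω and Ω'.
  obtain ⟨η, hη, hηc, hηs, hη1, hη0⟩ := exists_cutoff hΩ' hΩ hsub
  obtain ⟨θ, hθ, hθc, hθs, hθ1, hθ0⟩ := exists_cutoff hηc hΩ hηs
  obtain ⟨χ, hχ, hχc, hχs, hχ1, -⟩ := exists_cutoff hθc hΩ hθs
  obtain ⟨B, hB0, hB⟩ := exists_bound_derivatives hη hηc
  obtain ⟨r₁, hr₁, hl₁⟩ := exists_pos_line_subset hθc hΩ hθs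
    (W := fun z => (1, 0, 2 * z.2.1)) (by fun_prop)
  obtain ⟨r₂, hr₂, hl₂⟩ := exists_pos_line_subset hθc hΩ hθs
    (W := fun z => (0, 1, -2 * z.1)) (by fun_prop)
  obtain ⟨r, hr, hrr₁, hrr₂⟩ : ∃ r : ℝ, 0 < r ∧ r ≤ r₁ ∧ r ≤ r₂ :=
    ⟨min r₁ r₂, lt_min hr₁ hr₂, min_le_left _ _, min_le_right _ _⟩
  set D : ℝ := 3 * B * ((∫ z, (|X θ z| + |Y θ z|)) + ∫ z, θ z) with hD
  have hD0 : 0 ≤ D := mul_nonneg (by positivity)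
    (add_nonneg (integral_nonneg fun z => by positivity) (integral_nonneg hθ0))
  -- The added 1 keeps the constant positive even if D = 0, so the right-hand side is ∞ when the
  -- oscillation is infinite.
  refine ⟨D / r ^ 2 + 1, by positivity, fun u hu => ?_⟩
  have hint : IntegrableOn (maOp u) Ω' :=
    ((continuousOn_maOp hΩ hu.contDiffOn).mono hsub).integrableOn_compact hΩ'
  refine ⟨hint, ?_⟩
  have hC : ENNReal.ofReal (D / r ^ 2 + 1) ≠ 0 := by
    simpa using (by positivity : 0 < D / r ^ 2 + 1)
  by_cases hosc : osc Ω u = ∞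
  · rw [hosc, ENNReal.top_pow two_ne_zero, ENNReal.mul_top hC]
    exact le_top
  set O := (osc Ω u).toReal with hO
  have hO0 : 0 ≤ O := ENNReal.toReal_nonneg
  have hsubO : ∀ a ∈ Ω, ∀ b ∈ Ω, u a - u b ≤ O := fun a ha b hb => sub_le_toReal_osc hosc ha hb
  -- χu is globally C² with compact support, and agrees with u near supp θ, where all the estimates
  -- take place.
  set v : Point → ℝ := fun z => χ z * u z with hv
  have hvu : ∀ z ∈ tsupport θ, v =ᶠ[𝓝 z] u := fun z hz => by
    filter_upwards [eventually_nhdsSet_iff_forall.1 hχ1 z hz] with w hw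
    rw [hv]; simp only [hw, one_mul]
  have hθη : ∀ z ∈ tsupport η, θ z = 1 := fun z hz => hθ1.self_of_nhdsSet z hz
  have hηθ : tsupport η ⊆ tsupport θ := fun z hz => subset_closure (by simp [hθη z hz])
  have hps : ∀ z ∈ tsupport θ, (hess v z).PosSemidef := fun z hz => by
    rw [hess_congr (hvu z hz)]; exact hu.posSemidef z (hθs hz)
  obtain ⟨hi, hle⟩ := integral_mul_maOp_le (M := O / r) hη hηc
    (contDiff_mul_of_tsupport_subset hΩ hχ hχs hu.contDiffOn) hχc.mul_right
    (hθ.of_le (by norm_num)) hθc hθ0 hθη (by positivity) hB0 hB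
    (fun z hz => by
      rw [(X_congr (hvu z hz)).eq_of_nhds, (Y_congr (hvu z hz)).eq_of_nhds]
      exact ⟨abs_X_le hΩ hu hr (fun s hs => hl₁ z hz s (Set.Icc_subset_Icc
          (neg_le_neg hrr₁) hrr₁ hs)) hsubO,
        abs_Y_le hΩ hu hr (fun s hs => hl₂ z hz s (Set.Icc_subset_Icc
          (neg_le_neg hrr₂) hrr₂ hs)) hsubO⟩)
    (fun z hz => ⟨X_X_nonneg (hps z hz), Y_Y_nonneg (hps z hz), abs_offDiag_le (hps z hz)⟩)
  -- Nonnegativity of the operator on supp η allows the domain to be enlarged from Ω' to the whole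
  -- space.
  have hcmp : ∫ z in Ω', maOp u z ≤ ∫ z, η z * maOp v z := by
    have hη1' : ∀ z ∈ Ω', η z = 1 := fun z hz => hη1.self_of_nhdsSet z hz
    have e : ∫ z in Ω', maOp u z = ∫ z in Ω', η z * maOp v z := by
      refine setIntegral_congr_fun hΩ'.measurableSet fun z hz => ?_
      have hz' : z ∈ tsupport η := subset_closure (by simp [hη1' z hz])
      simp only [hη1' z hz, one_mul, maOp_congr (hvu z (hηθ hz'))]
    rw [e]
    refine setIntegral_le_integral hi (Eventually.of_forall fun z => ?_)
    by_cases hz : z ∈ tsupport η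
    · exact mul_nonneg (hη0 z) (maOp_nonneg (hps z (hηθ hz)))
    · simp [image_eq_zero_of_notMem_tsupport hz]
  have hfin : ∫ z in Ω', maOp u z ≤ (D / r ^ 2 + 1) * O ^ 2 := by
    refine hcmp.trans (hle.trans ?_)
    rw [← hD, div_pow, add_mul, one_mul, mul_div_assoc', div_mul_eq_mul_div]
    linarith [sq_nonneg O]
  calc ENNReal.ofReal (∫ z in Ω', maOp u z) ≤ ENNReal.ofReal ((D / r ^ 2 + 1) * O ^ 2) :=
        ENNReal.ofReal_le_ofReal hfin
    _ = ENNReal.ofReal (D / r ^ 2 + 1) * osc Ω u ^ 2 := by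
      rw [ENNReal.ofReal_mul (by positivity), ENNReal.ofReal_pow hO0, hO,
        ENNReal.ofReal_toReal hosc]
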